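/- Notation. Let $\mathbb D$ be the open unit disc in $\mathbb C$. A domain is a nonempty connected open subset of $\mathbb C^n$; a domain $D$ is balanced if $\lambda z\in D$ whenever $z\in D$ and $|\lambda|\le 1$, and then $h_D(z)=\inf\{t>0: z/t\in D\}$, $z\in\mathbb C^n$, is its Minkowski function. For a domain $D$ put $$\tilde k_D(z,w)=\inf\{\tanh^{-1}|\alpha| : \alpha\in\mathbb D,\ \exists\,\varphi:\mathbb D\to D \text{ holomorphic},\ \varphi(0)=z,\ \varphi(\alpha)=w\}$$ (the Lempert function) and $\tilde k_D^*=\tanh\tilde k_D$. A domain is pseudoconvex if it has a continuous plurisubharmonic exhaustion function. An analytic disc in a set $S\subset\mathbb C^n$ through $b$ is a holomorphic map $\varphi:\mathbb D\to\mathbb C^n$ with $b\in\varphi(\mathbb D)\subset S$; it is nontrivial if it is not constant. Proposition 3. Let $D\subset\mathbb C^n$ be a bounded balanced domain and let $G\subset\mathbb C^n$ be a pseudoconvex balanced domain with $G\supset D$. Let $a\in D$ be a point such that $h_D$ is continuous at $a$, $h_G(a)\ne 0$, and $\overline G$ contains no nontrivial analytic discs through $a/h_G(a)$. Then $$\tilde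 k_D^*(0,a)=h_G(a)\iff h_D(a)=h_G(a).$$ -/

import Mathlib

noncomputable section

open Set Metric

/-- `u` is a continuous plurisubharmonic function on the open set `U ⊆ ℂⁿ`: it is continuous on `U`
and satisfies the sub-mean value inequality on every closed disc `{z + ζ w : |ζ| ≤ 1}` of a complex
line that lies in `U`. -/
def ContinuousPSHOn {n : ℕ} (u : EuclideanSpace ℂ (Fin n) → ℝ)
    (U : Set (EuclideanSpace ℂ (Fin n))) : Prop :=
  ContinuousOn u U ∧
    ∀ z w : EuclideanSpace ℂ (Fin n), (∀ ζ : ℂ, ‖ζ‖ ≤ 1 → z + ζ • w ∈ U) →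
      u z ≤ Real.circleAverage (fun ζ : ℂ => u (z + ζ • w)) 0 1

/-- The open set `U ⊆ ℂⁿ` is pseudoconvex: it carries a continuous plurisubharmonic exhaustion
function, that is, one all of whose sublevel sets are compact subsets of `U`. -/
def IsPseudoconvex {n : ℕ} (U : Set (EuclideanSpace ℂ (Fin n))) : Prop :=
  ∃ u : EuclideanSpace ℂ (Fin n) → ℝ,
    ContinuousPSHOn u U ∧ ∀ c : ℝ, IsCompact {z ∈ U | u z ≤ c}

/-- `φ` restricts to a holomorphic map from the open unit disc of `ℂ` to `S ⊆ ℂⁿ`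
(an analytic disc in `S`). -/
def IsAnalyticDisc {n : ℕ} (φ : ℂ → EuclideanSpace ℂ (Fin n))
    (S : Set (EuclideanSpace ℂ (Fin n))) : Prop :=
  DifferentiableOn ℂ φ (ball 0 1) ∧ MapsTo φ (ball 0 1) S

/-- `S ⊆ ℂⁿ` contains no nontrivial analytic disc through `b`: every analytic disc in `S` that
passes through `b` is constant. -/
def NoNontrivialAnalyticDiscThrough {n : ℕ} (S : Set (EuclideanSpace ℂ (Fin n)))
    (b : EuclideanSpace ℂ (Fin n)) : Prop :=
  ∀ φ : ℂ → EuclideanSpace ℂ (Fin n), IsAnalyticDisc φ S → b ∈ φ '' ball 0 1 →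
    ∀ ζ ∈ ball (0 : ℂ) 1, φ ζ = b

/-- The Lempert function of `D`. -/
def lempert {n : ℕ} (D : Set (EuclideanSpace ℂ (Fin n))) (z w : EuclideanSpace ℂ (Fin n)) : ℝ :=
  sInf {r : ℝ | ∃ α ∈ ball (0 : ℂ) 1, ∃ φ : ℂ → EuclideanSpace ℂ (Fin n),
    IsAnalyticDisc φ D ∧ φ 0 = z ∧ φ α = w ∧ r = Real.artanh ‖α‖}

/-- The function `tanh` of the Lempert function of `D`. -/
def lempertStar {n : ℕ} (D : Set (EuclideanSpace ℂ (Fin n)))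
    (z w : EuclideanSpace ℂ (Fin n)) : ℝ :=
  Real.tanh (lempert D z w)

/-- The Minkowski function `h_D(z) = inf {t > 0 : z / t ∈ D}` of `D ⊆ ℂⁿ`. -/
def minkowski {n : ℕ} (D : Set (EuclideanSpace ℂ (Fin n))) (z : EuclideanSpace ℂ (Fin n)) : ℝ :=
  gauge D z

end

open Set Metric Filter Topology MeasureTheory

/-! Write s = h_G(a). The Schwarz lemma `minkowski_le_norm_of_isAnalyticDisc` gives s ≤ k̃*_D(0,a),
and the linear disc ζ ↦ ζa/h_D(a) gives k̃*_D(0,a) ≤ h_D(a); this settles the implication from right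
to left.

For the converse, boundedness of D yields a limit ψ of almost extremal discs φ_j with φ_j(t_j) = a
and t_j → s. Then ψ(ζ)/ζ is a disc in the closure of G through a/s, hence constant, so ψ(ζ) = ζa/s.
As φ_j(t) ∈ D tends to ta/s for 0 < t < 1, homogeneity and continuity of h_D at a give t·h_D(a) ≤ s;
let t → 1.

The Schwarz lemma rests on `smul_dslope_mem_of_isPseudoconvex`: the discs t·φ(rζ)/ζ, 0 ≤ t ≤ 1, have
boundaries in one compact subset of G, so the maximum principle for the exhaustion function keeps
them inside G. Plurisubharmonicity is assumed on complex lines only, so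
`le_of_forall_sphere_le_of_le_circleAverage` first smooths the function and then compares the disc
with its tangent line. -/

/-! ### Maximum principle for plurisubharmonic functions on analytic discs. -/

/-- Convolution with a bump averages the sub-mean inequality over translates, by Fubini. The bump
radius is at most `δ`, so translates of points of `K` stay in the thickening. -/
theorem exists_contDiff_approx_of_le_circleAverage {E : Type*} [NormedAddCommGroup E]
    [NormedSpace ℂ E] [FiniteDimensional ℂ E] {u : E → ℝ} (hu : Continuous u) {K : Set E}
    (hK : IsCompact K) {δ : ℝ} (hδ : 0 < δ)
    (hsub : ∀ z ∈ cthickening δ K, ∀ w : E, ‖w‖ ≤ δ →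
      u z ≤ Real.circleAverage (fun ζ : ℂ => u (z + ζ • w)) 0 1) {η : ℝ} (hη : 0 < η) :
    ∃ W : E → ℝ, ContDiff ℝ 1 W ∧ (∀ z ∈ K, |W z - u z| ≤ η) ∧
      ∀ z ∈ K, ∀ w : E, ‖w‖ ≤ δ →
        W z ≤ Real.circleAverage (fun ζ : ℂ => W (z + ζ • w)) 0 1 := by
  borelize E
  have : FiniteDimensional ℝ E := FiniteDimensional.complexToReal E
  let μ : Measure E := Measure.addHaar
  have hunif := hK.uniformContinuousAt_of_continuousAt u (fun a _ => hu.continuousAt)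
    (dist_mem_uniformity hη)
  obtain ⟨r, hr, hrη⟩ := Metric.mem_uniformity_dist.1 hunif
  have hs : 0 < min r δ := lt_min hr hδ
  let ρ : ContDiffBump (0 : E) := ⟨min r δ / 2, min r δ, by linarith, by linarith⟩
  let W : E → ℝ := convolution (ρ.normed μ) u (ContinuousLinearMap.lsmul ℝ ℝ) μ
  have hρc : HasCompactSupport (ρ.normed μ) := ρ.hasCompactSupport_normed
  have hρcont : Continuous (ρ.normed μ) := ρ.continuous_normed
  have hWdef : ∀ x, W x = ∫ t, ρ.normed μ t * u (x - t) ∂μ := fun x => by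
    simp [W, convolution_def]
  have hint : ∀ g : E → ℝ, Continuous g → Integrable (fun t => ρ.normed μ t * g t) μ := fun g hg =>
    (hρcont.mul hg).integrable_of_hasCompactSupport (hρc.mul_right)
  refine ⟨W, hρc.contDiff_convolution_left _ ρ.contDiff_normed hu.locallyIntegrable,
    fun z hz => ?_, fun z hz w hw => ?_⟩
  · rw [← Real.dist_eq]
    refine ρ.dist_normed_convolution_le hu.aestronglyMeasurable fun x hx => ?_
    have hx' : dist z x < r := by
      rw [dist_comm]; exact lt_of_lt_of_le (mem_ball.1 hx) (min_le_left _ _)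
    have := hrη hx' hz
    rw [dist_comm]; exact le_of_lt this
  · have hswap : Real.circleAverage (fun ζ : ℂ => W (z + ζ • w)) 0 1 =
        ∫ t, ρ.normed μ t * Real.circleAverage (fun ζ : ℂ => u (z - t + ζ • w)) 0 1 ∂μ := by
      simp only [Real.circleAverage_def, hWdef, smul_eq_mul]
      rw [intervalIntegral_integral_swap, ← integral_const_mul]
      · congr 1
        ext t
        rw [intervalIntegral.integral_const_mul, ← mul_assoc, ← mul_assoc, mul_comm (ρ.normed μ t)]
        congr 3
        ext θ
        congr 1
        abel
      · have hprod : (volume.restrict (uIoc 0 (2 * Real.pi))).prod μ =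
            (volume.prod μ).restrict (uIoc 0 (2 * Real.pi) ×ˢ univ) := by
          rw [← Measure.prod_restrict, Measure.restrict_univ]
        rw [hprod]
        have hcont : Continuous (Function.uncurry fun (θ : ℝ) (t : E) =>
            ρ.normed μ t * u (z + circleMap 0 1 θ • w - t)) := by
          have h1 : Continuous fun p : ℝ × E => circleMap 0 1 p.1 :=
            (continuous_circleMap 0 1).comp continuous_fst
          exact (hρcont.comp continuous_snd).mul
            (hu.comp ((continuous_const.add (h1.smul continuous_const)).sub continuous_snd))
        have hcpt : IsCompact (Icc (0 : ℝ) (2 * Real.pi) ×ˢ tsupport (ρ.normed μ)) :=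
          isCompact_Icc.prod hρc
        have hon := hcont.continuousOn.integrableOn_compact (μ := volume.prod μ) hcpt
        refine (hon.of_forall_sdiff_eq_zero
          (measurableSet_uIoc.prod MeasurableSet.univ) ?_)
        rintro ⟨θ, t⟩ ⟨h1, h2⟩
        have hθ : θ ∈ Icc (0 : ℝ) (2 * Real.pi) := by
          have := h1.1
          rw [uIoc_of_le Real.two_pi_pos.le] at this
          exact Ioc_subset_Icc_self this
        have ht : t ∉ tsupport (ρ.normed μ) := fun ht => h2 ⟨hθ, ht⟩
        simp [Function.uncurry, image_eq_zero_of_notMem_tsupport ht]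
    rw [hswap, hWdef]
    have hca : Continuous fun t : E => Real.circleAverage (fun ζ : ℂ => u (z - t + ζ • w)) 0 1 := by
      simp only [Real.circleAverage_def, smul_eq_mul]
      have h1 : Continuous fun p : E × ℝ => circleMap 0 1 p.2 :=
        (continuous_circleMap 0 1).comp continuous_snd
      have h2 : Continuous (Function.uncurry fun (t : E) (θ : ℝ) =>
          u (z - t + circleMap 0 1 θ • w)) :=
        hu.comp ((continuous_const.sub continuous_fst).add (h1.smul continuous_const))
      exact continuous_const.mul
        (intervalIntegral.continuous_parametric_intervalIntegral_of_continuous'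
          (μ := volume) h2 0 (2 * Real.pi))
    refine integral_mono (hint _ (hu.comp (continuous_const.sub continuous_id))) (hint _ hca)
      fun t => ?_
    by_cases ht : t ∈ ball (0 : E) (min r δ)
    · refine mul_le_mul_of_nonneg_left (hsub _ ?_ w hw) (ρ.nonneg_normed t)
      refine mem_cthickening_of_dist_le (z - t) z δ K hz ?_
      rw [mem_ball_zero_iff] at ht
      simpa [dist_eq_norm] using (ht.le.trans (min_le_right _ _))
    · have : ρ.normed μ t = 0 := by
        rw [← Function.notMem_support, ρ.support_normed_eq]; exact ht
      simp [this]

/-- Composing with a holomorphic disc preserves the sub-mean value inequality of a `C¹` function up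
to an error `o(r²)`. -/
theorem eventually_le_circleAverage_comp {E : Type*} [NormedAddCommGroup E]
    [NormedSpace ℂ E] [CompleteSpace E] {W : E → ℝ} (hW : ContDiff ℝ 1 W) {f : ℂ → E} {ζ₀ : ℂ}
    (hf : AnalyticAt ℂ f ζ₀) {δ : ℝ} (hδ : 0 < δ)
    (hsub : ∀ w : E, ‖w‖ ≤ δ →
      W (f ζ₀) ≤ Real.circleAverage (fun ζ : ℂ => W (f ζ₀ + ζ • w)) 0 1) {ε : ℝ} (hε : 0 < ε) :
    ∀ᶠ r in 𝓝[>] (0 : ℝ), W (f ζ₀) - ε * r ^ 2 ≤ Real.circleAverage (fun ζ => W (f ζ)) ζ₀ r := by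
  obtain ⟨R, hR, hfR⟩ := hf.exists_ball_analyticOnNhd
  have hfd : DifferentiableOn ℂ f (ball ζ₀ R) := hfR.differentiableOn
  have hnhds : ball ζ₀ R ∈ 𝓝 ζ₀ := ball_mem_nhds _ hR
  set c := deriv f ζ₀ with hc
  set g := dslope (dslope f ζ₀) ζ₀ with hg
  have hgd : DifferentiableOn ℂ g (ball ζ₀ R) :=
    (Complex.differentiableOn_dslope hnhds).2 ((Complex.differentiableOn_dslope hnhds).2 hfd)
  have hexp : ∀ ζ, f ζ = f ζ₀ + (ζ - ζ₀) • c + (ζ - ζ₀) ^ 2 • g ζ := fun ζ => by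
    have h1 := sub_smul_dslope f ζ₀ ζ
    have h2 := sub_smul_dslope (dslope f ζ₀) ζ₀ ζ
    rw [dslope_same] at h2
    rw [sq, mul_smul, hg, h2, smul_sub, h1, hc]
    abel
  set ℓ : ℂ → E := fun ζ => f ζ₀ + (ζ - ζ₀) • c with hℓ
  have hℓc : Continuous ℓ := by fun_prop
  have hgc : ContinuousAt g ζ₀ := (hgd.differentiableAt hnhds).continuousAt
  obtain ⟨M, hM⟩ : ∃ M : ℝ, ∀ᶠ ζ in 𝓝 ζ₀, ‖g ζ‖ < M :=
    ⟨‖g ζ₀‖ + 1, hgc.norm.eventually_lt_const (by linarith)⟩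
  have hM0 : 0 < M := lt_of_le_of_lt (norm_nonneg _) hM.self_of_nhds
  -- Strictness makes the error a small multiple of `‖f ζ - ℓ ζ‖ ≤ M r²`; plain differentiability at
  -- the centre would only give o(r).
  have hstrict : HasStrictFDerivAt W (fderiv ℝ W (f ζ₀)) (f ζ₀) :=
    hW.contDiffAt.hasStrictFDerivAt (by norm_num)
  set L := fderiv ℝ W (f ζ₀) with hL
  have hpair : Tendsto (fun ζ => (f ζ, ℓ ζ)) (𝓝 ζ₀) (𝓝 (f ζ₀, f ζ₀)) := by
    refine hf.continuousAt.prodMk_nhds ?_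
    have := hℓc.tendsto ζ₀
    simpa [hℓ] using this
  have hlit := hpair.eventually (hstrict.isLittleO.def (div_pos hε hM0))
  have hev : ∀ᶠ ζ in 𝓝 ζ₀, ‖g ζ‖ < M ∧
      ‖W (f ζ) - W (ℓ ζ) - L (f ζ - ℓ ζ)‖ ≤ ε / M * ‖f ζ - ℓ ζ‖ := hM.and hlit
  obtain ⟨s, hs, hball⟩ := Metric.eventually_nhds_iff_ball.1 hev
  have hlt : ∀ᶠ r in 𝓝[>] (0 : ℝ), r < min s (min R (δ / (‖c‖ + 1))) :=
    eventually_nhdsWithin_of_eventually_nhds (eventually_lt_nhds (by positivity))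
  filter_upwards [hlt, self_mem_nhdsWithin] with r hr hr0
  have hr0 : 0 < r := hr0
  obtain ⟨hrs, hrR, hrc⟩ : r < s ∧ r < R ∧ r < δ / (‖c‖ + 1) := by simpa using hr
  have hsph : sphere ζ₀ |r| ⊆ ball ζ₀ R := fun ζ hζ => by
    rw [abs_of_pos hr0, mem_sphere] at hζ
    rw [mem_ball]; linarith
  have hcf : ContinuousOn f (sphere ζ₀ |r|) := hfd.continuousOn.mono hsph
  have hci1 : CircleIntegrable (fun ζ => W (ℓ ζ)) ζ₀ r :=
    (hW.continuous.comp hℓc).continuousOn.circleIntegrable'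
  have hci2 : CircleIntegrable (fun ζ => L (f ζ - ℓ ζ)) ζ₀ r :=
    (L.continuous.comp_continuousOn (hcf.sub hℓc.continuousOn)).circleIntegrable'
  have hci3 : CircleIntegrable (fun ζ => W (f ζ)) ζ₀ r :=
    (hW.continuous.comp_continuousOn hcf).circleIntegrable'
  have hconst : CircleIntegrable (fun _ : ℂ => ε * r ^ 2) ζ₀ r :=
    continuousOn_const.circleIntegrable'
  have havg1 : W (f ζ₀) ≤ Real.circleAverage (fun ζ => W (ℓ ζ)) ζ₀ r := by
    rw [Real.circleAverage_eq_circleAverage_zero_one]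
    refine (hsub ((r : ℂ) • c) ?_).trans_eq ?_
    · rw [norm_smul, Complex.norm_real, Real.norm_of_nonneg hr0.le]
      have hpos : 0 < ‖c‖ + 1 := by positivity
      rw [lt_div_iff₀ hpos] at hrc
      nlinarith [norm_nonneg c]
    · congr 1
      ext ζ
      simp only [hℓ, add_sub_cancel_right, smul_smul, mul_comm]
  -- `L` is only real linear, but it commutes with averaging, and `f - ℓ` is holomorphic and
  -- vanishes at the centre.
  have havg2 : Real.circleAverage (fun ζ => L (f ζ - ℓ ζ)) ζ₀ r = 0 := by
    have h1 := L.circleAverage_comp_comm (f := fun ζ => f ζ - ℓ ζ) (c := ζ₀) (R := r)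
      (hcf.sub hℓc.continuousOn).circleIntegrable'
    have h2 : DiffContOnCl ℂ (fun ζ => f ζ - ℓ ζ) (ball ζ₀ |r|) := by
      have hcl : closure (ball ζ₀ |r|) ⊆ ball ζ₀ R := by
        refine closure_ball_subset_closedBall.trans (closedBall_subset_ball ?_)
        rwa [abs_of_pos hr0]
      refine DifferentiableOn.diffContOnCl ((hfd.mono hcl).sub ?_)
      exact Differentiable.differentiableOn (by fun_prop)
    have h3 := h2.circleAverage
    rw [show (L ∘ fun ζ => f ζ - ℓ ζ) = fun ζ => L (f ζ - ℓ ζ) from rfl, h3] at h1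
    rw [h1]
    simp [hℓ]
  have hle : Real.circleAverage (fun ζ => W (ℓ ζ) + L (f ζ - ℓ ζ)) ζ₀ r ≤
      Real.circleAverage (fun ζ => W (f ζ) + ε * r ^ 2) ζ₀ r := by
    refine Real.circleAverage_mono (hci1.add hci2) (hci3.add hconst) fun ζ hζ => ?_
    rw [abs_of_pos hr0, mem_sphere] at hζ
    obtain ⟨hg1, hg2⟩ := hball ζ (by rw [mem_ball]; linarith)
    have hfl : f ζ - ℓ ζ = (ζ - ζ₀) ^ 2 • g ζ := by
      rw [hexp ζ]; simp [hℓ]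
    have hnorm : ‖f ζ - ℓ ζ‖ ≤ r ^ 2 * M := by
      rw [hfl, norm_smul, norm_pow, ← dist_eq_norm, hζ]
      gcongr
    have hb : ε / M * ‖f ζ - ℓ ζ‖ ≤ ε * r ^ 2 := by
      calc ε / M * ‖f ζ - ℓ ζ‖ ≤ ε / M * (r ^ 2 * M) := by gcongr
        _ = ε * r ^ 2 := by field_simp
    have := (abs_le.1 ((Real.norm_eq_abs _).symm.trans_le (hg2.trans hb))).1
    linarith
  rw [Real.circleAverage_fun_add hci1 hci2, Real.circleAverage_fun_add hci3 hconst, havg2,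
    Real.circleAverage_const] at hle
  linarith

/-- The gain of r² lets a small multiple of |ζ|² absorb the o(r²) error in the maximum principle. -/
theorem circleAverage_norm_sq (ζ₀ : ℂ) (r : ℝ) :
    Real.circleAverage (fun ζ : ℂ => ‖ζ‖ ^ 2) ζ₀ r = ‖ζ₀‖ ^ 2 + r ^ 2 := by
  have hlin : Real.circleAverage
      (fun ζ : ℂ => Complex.reCLM ((starRingEnd ℂ ζ₀) * (ζ - ζ₀))) ζ₀ r = 0 := by
    have hd : Differentiable ℂ fun ζ : ℂ => (starRingEnd ℂ ζ₀) * (ζ - ζ₀) := by fun_prop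
    have h1 := Complex.reCLM.circleAverage_comp_comm
      (f := fun ζ : ℂ => (starRingEnd ℂ ζ₀) * (ζ - ζ₀)) (c := ζ₀) (R := r)
      hd.continuous.continuousOn.circleIntegrable'
    rw [(hd.diffContOnCl).circleAverage] at h1
    simpa [Function.comp_def] using h1
  have hci : CircleIntegrable
      (fun ζ : ℂ => Complex.reCLM ((starRingEnd ℂ ζ₀) * (ζ - ζ₀))) ζ₀ r :=
    Continuous.continuousOn (by fun_prop) |>.circleIntegrable'
  calc Real.circleAverage (fun ζ : ℂ => ‖ζ‖ ^ 2) ζ₀ r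
      = Real.circleAverage (fun ζ : ℂ => (2 : ℝ) • Complex.reCLM ((starRingEnd ℂ ζ₀) * (ζ - ζ₀))
          + (‖ζ₀‖ ^ 2 + r ^ 2)) ζ₀ r := by
        refine Real.circleAverage_congr_sphere fun ζ hζ => ?_
        have h1 : ‖ζ - ζ₀‖ ^ 2 = r ^ 2 := by
          rw [← dist_eq_norm, mem_sphere.1 hζ, sq_abs]
        simp only [← h1, Complex.sq_norm, Complex.normSq_apply, Complex.reCLM_apply, smul_eq_mul,
          Complex.mul_re, Complex.conj_re, Complex.conj_im, Complex.sub_re, Complex.sub_im]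
        ring
    _ = _ := by
        rw [Real.circleAverage_fun_add (f₁ := fun ζ : ℂ => (2 : ℝ) •
          Complex.reCLM ((starRingEnd ℂ ζ₀) * (ζ - ζ₀)))
          (hci.const_smul) (continuousOn_const.circleIntegrable'),
          Real.circleAverage_fun_smul, hlin, Real.circleAverage_const]
        simp

/-- The maximum principle for a continuous plurisubharmonic function on an analytic disc. -/
theorem le_of_forall_sphere_le_of_le_circleAverage {E : Type*} [NormedAddCommGroup E]
    [NormedSpace ℂ E] [FiniteDimensional ℂ E] {U : Set E} (hU : IsOpen U) {u : E → ℝ}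
    (hu : ContinuousOn u U)
    (hsub : ∀ z w : E, (∀ ζ : ℂ, ‖ζ‖ ≤ 1 → z + ζ • w ∈ U) →
      u z ≤ Real.circleAverage (fun ζ : ℂ => u (z + ζ • w)) 0 1)
    {f : ℂ → E} (hf : ContinuousOn f (closedBall 0 1)) (hfd : DifferentiableOn ℂ f (ball 0 1))
    (hfU : MapsTo f (closedBall 0 1) U) {M : ℝ} (hM : ∀ ζ ∈ sphere (0 : ℂ) 1, u (f ζ) ≤ M)
    {ζ : ℂ} (hζ : ζ ∈ closedBall (0 : ℂ) 1) : u (f ζ) ≤ M := by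
  have : CompleteSpace E := FiniteDimensional.complete ℂ E
  by_contra! hlt
  have hK : IsCompact (f '' closedBall 0 1) := (isCompact_closedBall 0 1).image_of_continuousOn hf
  have : ProperSpace E := FiniteDimensional.proper ℂ E
  set K := f '' closedBall 0 1 with hKdef
  obtain ⟨δ, hδ, hδU⟩ := hK.exists_cthickening_subset_open hU (image_subset_iff.2 hfU)
  -- Tietze extension: smoothing needs a globally continuous function, but only values near `K`
  -- matter.
  obtain ⟨v, hv⟩ := ContinuousMap.exists_restrict_eq (isClosed_cthickening (δ := δ) (E := K))
    ⟨(cthickening δ K).domRestrict u, (hu.mono hδU).domRestrict⟩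
  have hvu : ∀ z ∈ cthickening δ K, v z = u z := fun z hz => DFunLike.congr_fun hv ⟨z, hz⟩
  have hth : ∀ z ∈ cthickening (δ / 2) K, ∀ x, ‖x‖ ≤ δ / 2 → z + x ∈ cthickening δ K := by
    intro z hz x hx
    have : z + x ∈ cthickening (δ / 2) (cthickening (δ / 2) K) :=
      mem_cthickening_of_dist_le _ z _ _ hz (by simpa [dist_eq_norm] using hx)
    have h2 := cthickening_cthickening_subset (by positivity) (by positivity) K this
    simpa using h2
  -- One `η` is lost by smoothing at `ζ`, one by smoothing on the circle, one to the term `η‖ξ‖²`;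
  -- the maximum of `g` is then interior.
  obtain ⟨η, hη, hηlt⟩ : ∃ η : ℝ, 0 < η ∧ M + 3 * η < u (f ζ) :=
    ⟨(u (f ζ) - M) / 4, by linarith, by linarith⟩
  obtain ⟨W, hW, hWv, hWsub⟩ := exists_contDiff_approx_of_le_circleAverage v.continuous hK
    (half_pos hδ) (fun z hz w hw => by
      have hmem : ∀ ζ : ℂ, ‖ζ‖ ≤ 1 → z + ζ • w ∈ cthickening δ K := fun ζ hζ => hth z hz _ <| by
        rw [norm_smul]; nlinarith [norm_nonneg w, norm_nonneg ζ]
      have h0 := hmem 0 (by simp)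
      rw [zero_smul, add_zero] at h0
      rw [hvu z h0]
      refine (hsub z w fun ζ hζ => hδU (hmem ζ hζ)).trans_eq ?_
      refine Real.circleAverage_congr_sphere fun ζ hζ => (hvu _ (hmem ζ ?_)).symm
      simpa using hζ.le) hη
  have hWu : ∀ ξ ∈ closedBall (0 : ℂ) 1, |W (f ξ) - u (f ξ)| ≤ η := fun ξ hξ => by
    rw [← hvu _ (self_subset_cthickening K (mem_image_of_mem f hξ))]
    exact hWv _ (mem_image_of_mem f hξ)
  set g : ℂ → ℝ := fun ξ => W (f ξ) + η * ‖ξ‖ ^ 2 with hg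
  have hgc : ContinuousOn g (closedBall 0 1) :=
    (hW.continuous.comp_continuousOn hf).add (by fun_prop)
  obtain ⟨ζ₀, hζ₀, hmax⟩ := (isCompact_closedBall (0 : ℂ) 1).exists_isMaxOn ⟨ζ, hζ⟩ hgc
  have hgζ : M + 2 * η < g ζ₀ := by
    have h1 := hmax hζ
    have h2 := (abs_le.1 (hWu ζ hζ)).1
    have h3 : 0 ≤ η * ‖ζ‖ ^ 2 := by positivity
    simp only [mem_ofPred_eq, hg] at h1 ⊢
    linarith
  have hint : ζ₀ ∈ ball (0 : ℂ) 1 := by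
    rw [mem_ball_zero_iff]
    rw [mem_closedBall_zero_iff] at hζ₀
    refine lt_of_le_of_ne hζ₀ fun h => ?_
    have h1 := hM ζ₀ (by simpa using h)
    have h2 := (abs_le.1 (hWu ζ₀ (by simp [h]))).2
    simp only [hg, h] at hgζ
    linarith
  -- Small circles about the maximum point have average at least `g ζ₀ + (η - η / 2) r²`, a
  -- contradiction.
  have han : AnalyticAt ℂ f ζ₀ := hfd.analyticAt (isOpen_ball.mem_nhds hint)
  have hev := eventually_le_circleAverage_comp hW han (half_pos hδ)
    (hWsub _ (mem_image_of_mem f hζ₀)) (half_pos hη)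
  have hlt1 : ∀ᶠ r in 𝓝[>] (0 : ℝ), r < 1 - ‖ζ₀‖ :=
    eventually_nhdsWithin_of_eventually_nhds
      (eventually_lt_nhds (by simpa using hint))
  obtain ⟨r, ⟨hr1, hr2⟩, hr0⟩ := ((hev.and hlt1).and self_mem_nhdsWithin).exists
  have hr0 : 0 < r := hr0
  have hsph : sphere ζ₀ |r| ⊆ closedBall 0 1 := fun ξ hξ => by
    rw [abs_of_pos hr0, mem_sphere, dist_eq_norm] at hξ
    rw [mem_closedBall_zero_iff]
    have := norm_add_le (ξ - ζ₀) ζ₀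
    rw [sub_add_cancel] at this
    linarith
  have hciW : CircleIntegrable (fun ξ => W (f ξ)) ζ₀ r :=
    (hW.continuous.comp_continuousOn (hf.mono hsph)).circleIntegrable'
  have hciN : CircleIntegrable (fun ξ : ℂ => ‖ξ‖ ^ 2) ζ₀ r :=
    Continuous.continuousOn (by fun_prop) |>.circleIntegrable'
  have hle : Real.circleAverage g ζ₀ r ≤ g ζ₀ :=
    Real.circleAverage_mono_on_of_le_circle (hgc.mono hsph).circleIntegrable'
      fun ξ hξ => hmax (hsph hξ)
  have hval : Real.circleAverage g ζ₀ r =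
      Real.circleAverage (fun ξ => W (f ξ)) ζ₀ r + η * (‖ζ₀‖ ^ 2 + r ^ 2) := by
    rw [hg, Real.circleAverage_fun_add (f₁ := fun ξ => W (f ξ)) (f₂ := fun ξ : ℂ => η * ‖ξ‖ ^ 2)
      hciW (hciN.const_smul (a := η)), ← circleAverage_norm_sq]
    congr 1
    exact Real.circleAverage_fun_smul (a := η) (f := fun ξ : ℂ => ‖ξ‖ ^ 2)
  rw [hval] at hle
  simp only [hg] at hle
  nlinarith [pow_pos hr0 2]

/-! ### Division of a disc by its coordinate, and the Schwarz lemma. -/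

theorem differentiableOn_dslope_zero {E : Type*} [NormedAddCommGroup E] [NormedSpace ℂ E]
    [CompleteSpace E] {φ : ℂ → E} (hφ : DifferentiableOn ℂ φ (ball 0 1)) :
    DifferentiableOn ℂ (dslope φ 0) (ball 0 1) :=
  (Complex.differentiableOn_dslope (ball_mem_nhds _ one_pos)).2 hφ

theorem dslope_zero_eq_inv_smul {E : Type*} [NormedAddCommGroup E] [NormedSpace ℂ E] {φ : ℂ → E}
    (h0 : φ 0 = 0) {ζ : ℂ} (hζ : ζ ≠ 0) : dslope φ 0 ζ = ζ⁻¹ • φ ζ := by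
  rw [dslope_of_ne _ hζ, slope_def_module, sub_zero, h0, sub_zero]

/-- An instance of the continuity principle: an analytic disc in a pseudoconvex balanced open set
that is centred at the origin may be divided by the coordinate of the disc. -/
theorem smul_dslope_mem_of_isPseudoconvex {n : ℕ} {G : Set (EuclideanSpace ℂ (Fin n))}
    (hG : IsOpen G) (hbal : Balanced ℂ G) (hpsc : IsPseudoconvex G)
    {φ : ℂ → EuclideanSpace ℂ (Fin n)} (hφ : IsAnalyticDisc φ G) (h0 : φ 0 = 0) {r : ℝ}
    (hr0 : 0 < r) (hr1 : r < 1) {ζ : ℂ} (hζ : ζ ∈ closedBall (0 : ℂ) 1) :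
    (r : ℂ) • dslope φ 0 (r * ζ) ∈ G := by
  obtain ⟨u, ⟨hu, hsub⟩, hcpt⟩ := hpsc
  have hrζ : ∀ ζ ∈ closedBall (0 : ℂ) 1, (r : ℂ) * ζ ∈ closedBall (0 : ℂ) r := fun ζ hζ => by
    rw [mem_closedBall_zero_iff] at hζ ⊢
    rw [norm_mul, Complex.norm_real, Real.norm_of_nonneg hr0.le]
    nlinarith
  have hsubball : closedBall (0 : ℂ) r ⊆ ball 0 1 := closedBall_subset_ball hr1
  set F : ℂ → EuclideanSpace ℂ (Fin n) := fun ζ => (r : ℂ) • dslope φ 0 (r * ζ) with hF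
  have hd := differentiableOn_dslope_zero hφ.1
  have hFd : DifferentiableOn ℂ F (closedBall 0 1) :=
    (hd.comp (t := ball 0 1) (s := closedBall 0 1) (f := fun ζ : ℂ => (r : ℂ) * ζ) (by fun_prop)
      fun ζ hζ => hsubball (hrζ ζ hζ)).const_smul (r : ℂ)
  have hFs : ∀ ζ ∈ sphere (0 : ℂ) 1, F ζ = ζ⁻¹ • φ (r * ζ) := fun ζ hζ => by
    have hne : ζ ≠ 0 := by
      rintro rfl
      simp at hζ
    have hr : (r : ℂ) ≠ 0 := by exact_mod_cast hr0.ne'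
    rw [hF]
    simp only
    rw [dslope_zero_eq_inv_smul h0 (mul_ne_zero hr hne), smul_smul]
    congr 1
    field_simp
  -- On the unit circle `t • F ζ` equals `(t ζ⁻¹) • φ (r ζ)`, so this compact set holds the
  -- boundaries of all the discs `t • F`, and `G` contains it by balancedness.
  have hK : IsCompact ((fun p : ℂ × ℂ => p.1 • φ p.2) '' closedBall 0 1 ×ˢ closedBall 0 r) := by
    refine ((isCompact_closedBall _ _).prod (isCompact_closedBall _ _)).image_of_continuousOn ?_
    refine continuousOn_fst.smul ((hφ.1.continuousOn.mono hsubball).comp continuousOn_snd ?_)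
    exact fun p hp => hp.2
  have hKG : (fun p : ℂ × ℂ => p.1 • φ p.2) '' closedBall 0 1 ×ˢ closedBall 0 r ⊆ G := by
    rintro _ ⟨p, hp, rfl⟩
    exact hbal.smul_mem (by simpa using hp.1) (hφ.2 (hsubball hp.2))
  obtain ⟨M, hM⟩ := (hK.image_of_continuousOn (hu.mono hKG)).bddAbove
  have hC : IsCompact (F '' closedBall 0 1) :=
    (isCompact_closedBall _ _).image_of_continuousOn hFd.continuousOn
  -- Continuity method: the maximum principle upgrades membership in `G` to membership in a compact
  -- sublevel set, a closed condition; openness comes from compactness of the disc.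
  set S : Set ℝ := {t | ∀ z ∈ F '' closedBall 0 1, (t : ℂ) • z ∈ G} with hS
  have hSM : S ∩ Icc 0 1 =
      (⋂ z ∈ F '' closedBall 0 1, (fun t : ℝ => (t : ℂ) • z) ⁻¹' {z ∈ G | u z ≤ M}) ∩ Icc 0 1 := by
    ext t
    simp only [mem_inter_iff, mem_iInter, mem_preimage, and_congr_left_iff]
    refine fun ht => ⟨fun h z hz => ⟨h z hz, ?_⟩, fun h z hz => (h z hz).1⟩
    obtain ⟨ξ, hξ, rfl⟩ := hz
    refine le_of_forall_sphere_le_of_le_circleAverage (f := fun ξ => (t : ℂ) • F ξ) hG hu hsub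
      (hFd.continuousOn.const_smul (t : ℂ)) ((hFd.mono ball_subset_closedBall).const_smul (t : ℂ))
      (fun ξ hξ => h _ (mem_image_of_mem F hξ)) (fun ξ hξ => ?_) hξ
    refine hM (mem_image_of_mem u ⟨((t : ℂ) * ξ⁻¹, r * ξ),
      ⟨?_, hrζ ξ (sphere_subset_closedBall hξ)⟩, ?_⟩)
    · have : ‖ξ‖ = 1 := by simpa using hξ
      simpa [this, abs_of_nonneg ht.1] using ht.2
    · simp [hFs ξ hξ, smul_smul]
  have hclosed : IsClosed (S ∩ Icc 0 1) := by
    rw [hSM]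
    refine IsClosed.inter (isClosed_biInter fun z _ => (hcpt M).isClosed.preimage ?_) isClosed_Icc
    exact Complex.continuous_ofReal.smul continuous_const
  have hzero : (0 : ℝ) ∈ S := fun z _ => by
    have := hφ.2 (mem_ball_self one_pos)
    rw [h0] at this
    simpa using this
  have hsubset : Icc 0 1 ⊆ S := by
    refine hclosed.Icc_subset_of_forall_exists_gt hzero fun t ht y hy => ?_
    have hev : ∀ᶠ s : ℝ in 𝓝 t, s ∈ S := by
      refine hC.eventually_forall_of_forall_eventually fun z hz => ?_
      have hcont : Continuous fun p : ℝ × EuclideanSpace ℂ (Fin n) => (p.1 : ℂ) • p.2 :=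
        (Complex.continuous_ofReal.comp continuous_fst).smul continuous_snd
      exact hcont.continuousAt.eventually (hG.mem_nhds (ht.1 z hz))
    have h2 : ∀ᶠ s : ℝ in 𝓝[>] t, s ∈ S ∩ Ioc t y :=
      (eventually_nhdsWithin_of_eventually_nhds hev).and (Ioc_mem_nhdsGT hy)
    exact h2.exists
  have h1 := hsubset (right_mem_Icc.2 zero_le_one) _ (mem_image_of_mem F hζ)
  rwa [Complex.ofReal_one, one_smul] at h1

theorem smul_dslope_mem_of_norm_le {n : ℕ} {G : Set (EuclideanSpace ℂ (Fin n))}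
    (hG : IsOpen G) (hbal : Balanced ℂ G) (hpsc : IsPseudoconvex G)
    {φ : ℂ → EuclideanSpace ℂ (Fin n)} (hφ : IsAnalyticDisc φ G) (h0 : φ 0 = 0) {r : ℝ}
    (hr0 : 0 < r) (hr1 : r < 1) {ζ : ℂ} (hζ : ‖ζ‖ ≤ r) : (r : ℂ) • dslope φ 0 ζ ∈ G := by
  have hr : (r : ℂ) ≠ 0 := by exact_mod_cast hr0.ne'
  have h := smul_dslope_mem_of_isPseudoconvex hG hbal hpsc hφ h0 hr0 hr1 (ζ := ζ / r) (by
    rw [mem_closedBall_zero_iff, norm_div, Complex.norm_real, Real.norm_of_nonneg hr0.le]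
    exact div_le_one_of_le₀ hζ hr0.le)
  rwa [mul_div_cancel₀ _ hr] at h

theorem eventually_smul_dslope_mem {n : ℕ} {G : Set (EuclideanSpace ℂ (Fin n))}
    (hG : IsOpen G) (hbal : Balanced ℂ G) (hpsc : IsPseudoconvex G)
    {φ : ℂ → EuclideanSpace ℂ (Fin n)} (hφ : IsAnalyticDisc φ G) (h0 : φ 0 = 0) {ζ : ℂ}
    (hζ : ζ ∈ ball (0 : ℂ) 1) : ∀ᶠ r : ℝ in 𝓝[<] 1, (r : ℂ) • dslope φ 0 ζ ∈ G := by
  filter_upwards [Ioo_mem_nhdsLT (mem_ball_zero_iff.1 hζ)] with r hr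
  exact smul_dslope_mem_of_norm_le hG hbal hpsc hφ h0 ((norm_nonneg _).trans_lt hr.1) hr.2 hr.1.le

theorem dslope_mem_closure_of_isPseudoconvex {n : ℕ} {G : Set (EuclideanSpace ℂ (Fin n))}
    (hG : IsOpen G) (hbal : Balanced ℂ G) (hpsc : IsPseudoconvex G)
    {φ : ℂ → EuclideanSpace ℂ (Fin n)} (hφ : IsAnalyticDisc φ G) (h0 : φ 0 = 0) {ζ : ℂ}
    (hζ : ζ ∈ ball (0 : ℂ) 1) : dslope φ 0 ζ ∈ closure G := by
  have hcont : Continuous fun r : ℝ => (r : ℂ) • dslope φ 0 ζ :=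
    Complex.continuous_ofReal.smul continuous_const
  have htend := (hcont.tendsto 1).mono_left (nhdsWithin_le_nhds (s := Iio 1))
  simp only [Complex.ofReal_one, one_smul] at htend
  exact mem_closure_of_tendsto htend (eventually_smul_dslope_mem hG hbal hpsc hφ h0 hζ)

theorem minkowski_smul {n : ℕ} {D : Set (EuclideanSpace ℂ (Fin n))} (hbal : Balanced ℂ D) (c : ℂ)
    (z : EuclideanSpace ℂ (Fin n)) : minkowski D (c • z) = ‖c‖ * minkowski D z :=
  gauge_smul hbal c z

/-- The Schwarz lemma for discs in a pseudoconvex balanced open set. -/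
theorem minkowski_le_norm_of_isAnalyticDisc {n : ℕ} {G : Set (EuclideanSpace ℂ (Fin n))}
    (hG : IsOpen G) (hbal : Balanced ℂ G) (hpsc : IsPseudoconvex G)
    {φ : ℂ → EuclideanSpace ℂ (Fin n)} (hφ : IsAnalyticDisc φ G) (h0 : φ 0 = 0) {ζ : ℂ}
    (hζ : ζ ∈ ball (0 : ℂ) 1) : minkowski G (φ ζ) ≤ ‖ζ‖ := by
  have hcont : Continuous fun r : ℝ => r * minkowski G (dslope φ 0 ζ) := by fun_prop
  have htend := (hcont.tendsto 1).mono_left (nhdsWithin_le_nhds (s := Iio 1))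
  have hle : minkowski G (dslope φ 0 ζ) ≤ 1 := by
    rw [one_mul] at htend
    refine le_of_tendsto htend ?_
    filter_upwards [eventually_smul_dslope_mem hG hbal hpsc hφ h0 hζ,
      Ioo_mem_nhdsLT zero_lt_one] with r hr hr1
    have h := gauge_le_one_of_mem hr
    change minkowski G _ ≤ 1 at h
    rwa [minkowski_smul hbal, Complex.norm_real, Real.norm_of_nonneg hr1.1.le] at h
  have hφζ : φ ζ = ζ • dslope φ 0 ζ := by
    have := sub_smul_dslope φ 0 ζ
    rw [h0, sub_zero, sub_zero] at this
    exact this.symm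
  rw [hφζ, minkowski_smul hbal]
  exact mul_le_of_le_one_right (norm_nonneg _) hle

theorem strictMono_tanh : StrictMono Real.tanh := fun x y h =>
  (Real.artanh_lt_artanh_iff (Real.tanh_bijOn.mapsTo trivial) (Real.tanh_bijOn.mapsTo trivial)).1
    (by rwa [Real.artanh_tanh, Real.artanh_tanh])

theorem minkowski_nonneg {n : ℕ} (D : Set (EuclideanSpace ℂ (Fin n)))
    (z : EuclideanSpace ℂ (Fin n)) : 0 ≤ minkowski D z :=
  gauge_nonneg z

/-! ### Normal families of bounded discs. -/

/-- A uniformly bounded family of holomorphic maps on the unit disc is uniformly Lipschitz on smaller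
discs. -/
theorem norm_sub_le_of_differentiableOn_of_norm_le {E : Type*} [NormedAddCommGroup E]
    [NormedSpace ℂ E] {φ : ℂ → E} (hφ : DifferentiableOn ℂ φ (ball 0 1)) {B : ℝ}
    (hB : ∀ ζ ∈ ball (0 : ℂ) 1, ‖φ ζ‖ ≤ B) {r : ℝ} (hr : r < 1) {x y : ℂ}
    (hx : x ∈ closedBall (0 : ℂ) r) (hy : y ∈ closedBall (0 : ℂ) r) :
    ‖φ y - φ x‖ ≤ B / ((1 - r) / 2) * ‖y - x‖ := by
  have hsub : ∀ z ∈ closedBall (0 : ℂ) r, closedBall z ((1 - r) / 2) ⊆ ball 0 1 := fun z hz => by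
    rw [mem_closedBall] at hz
    exact closedBall_subset_ball' (by linarith)
  refine (convex_closedBall (0 : ℂ) r).norm_image_sub_le_of_norm_deriv_le (𝕜 := ℂ) (fun z hz => ?_)
    (fun z hz => ?_) hx hy
  · exact hφ.differentiableAt (isOpen_ball.mem_nhds
      (hsub z hz (mem_closedBall_self (by linarith))))
  · refine Complex.norm_deriv_le_of_forall_mem_sphere_norm_le (by linarith) ?_ fun w hw =>
      hB w (hsub z hz (sphere_subset_closedBall hw))
    exact (hφ.mono (closure_ball_subset_closedBall.trans (hsub z hz))).diffContOnCl

/-- A form of Montel's theorem: a pointwise limit of uniformly bounded holomorphic maps is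
holomorphic. -/
theorem differentiableOn_of_tendsto_of_norm_le {E ι : Type*} [NormedAddCommGroup E]
    [NormedSpace ℂ E] [CompleteSpace E] {l : Filter ι} [l.NeBot] {φ : ι → ℂ → E} {ψ : ℂ → E}
    (hφ : ∀ i, DifferentiableOn ℂ (φ i) (ball 0 1)) {B : ℝ}
    (hB : ∀ i, ∀ ζ ∈ ball (0 : ℂ) 1, ‖φ i ζ‖ ≤ B)
    (hlim : ∀ ζ ∈ ball (0 : ℂ) 1, Tendsto (fun i => φ i ζ) l (𝓝 (ψ ζ))) :
    DifferentiableOn ℂ ψ (ball 0 1) := by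
  have hloc : TendstoLocallyUniformlyOn φ ψ l (ball 0 1) := by
    rw [tendstoLocallyUniformlyOn_iff_forall_isCompact isOpen_ball]
    intro K hK hKc
    -- Equicontinuity turns pointwise convergence into uniform convergence on compact sets.
    have heq : EquicontinuousOn φ K := by
      intro x hx
      obtain ⟨r, hxr, hr⟩ := exists_between (mem_ball_zero_iff.1 (hK hx))
      refine (Metric.equicontinuousAt_of_continuity_modulus
        (fun y => B / ((1 - r) / 2) * ‖y - x‖) ?_ φ ?_).equicontinuousWithinAt K
      · have hc : Continuous fun y : ℂ => B / ((1 - r) / 2) * ‖y - x‖ := by fun_prop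
        simpa using hc.tendsto x
      · filter_upwards [isOpen_ball.mem_nhds (mem_ball_zero_iff.2 hxr)] with y hy i
        rw [dist_comm, dist_eq_norm]
        exact norm_sub_le_of_differentiableOn_of_norm_le (hφ i) (hB i) hr
          (mem_closedBall_zero_iff.2 hxr.le) (ball_subset_closedBall hy)
    have := (EquicontinuousOn.tendsto_uniformOnFun_iff_pi' (𝔖 := {K}) (F := φ) (by simpa using hKc)
      (by simpa using heq) l ψ).2 (by
        rw [tendsto_pi_nhds]
        rintro ⟨ζ, hζ⟩
        exact hlim ζ (hK (by simpa using hζ)))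
    exact UniformOnFun.tendsto_iff_tendstoUniformlyOn.1 this K rfl
  exact hloc.differentiableOn (Eventually.of_forall hφ) isOpen_ball

theorem tendsto_comp_of_tendsto_of_norm_le {E ι : Type*} [NormedAddCommGroup E]
    [NormedSpace ℂ E] {l : Filter ι} {φ : ι → ℂ → E} {p : E}
    (hφ : ∀ i, DifferentiableOn ℂ (φ i) (ball 0 1)) {B : ℝ}
    (hB : ∀ i, ∀ ζ ∈ ball (0 : ℂ) 1, ‖φ i ζ‖ ≤ B) {s : ℂ} (hs : s ∈ ball (0 : ℂ) 1) {α : ι → ℂ}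
    (hα : Tendsto α l (𝓝 s)) (hp : Tendsto (fun i => φ i s) l (𝓝 p)) :
    Tendsto (fun i => φ i (α i)) l (𝓝 p) := by
  obtain ⟨r, hsr, hr⟩ := exists_between (mem_ball_zero_iff.1 hs)
  have hev : ∀ᶠ i in l, α i ∈ closedBall (0 : ℂ) r :=
    hα.eventually (mem_of_superset (isOpen_ball.mem_nhds (mem_ball_zero_iff.2 hsr))
      ball_subset_closedBall)
  have h0 : Tendsto (fun i => φ i (α i) - φ i s) l (𝓝 0) := by
    have hz : Tendsto (fun i => B / ((1 - r) / 2) * ‖α i - s‖) l (𝓝 0) := by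
      have := ((hα.sub_const s).norm).const_mul (B / ((1 - r) / 2))
      simpa using this
    refine squeeze_zero_norm' ?_ hz
    filter_upwards [hev] with i hi
    exact norm_sub_le_of_differentiableOn_of_norm_le (hφ i) (hB i) hr
      (mem_closedBall_zero_iff.2 hsr.le) hi
  simpa using h0.add hp

/-! ### The Lempert function at the origin and its almost extremal discs. -/

/-- The upper bound of the Lempert function by the linear disc. -/
theorem exists_linear_disc {n : ℕ} {D : Set (EuclideanSpace ℂ (Fin n))} (hD : IsOpen D)
    (hbal : Balanced ℂ D) {a : EuclideanSpace ℂ (Fin n)} (ha : a ∈ D) (hDa : 0 < minkowski D a) :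
    minkowski D a < 1 ∧ ∃ φ : ℂ → EuclideanSpace ℂ (Fin n), IsAnalyticDisc φ D ∧ φ 0 = 0 ∧
      φ (minkowski D a : ℂ) = a := by
  have hne : (minkowski D a : ℂ) ≠ 0 := by exact_mod_cast hDa.ne'
  refine ⟨gauge_lt_one_of_mem_of_isOpen hD ha, fun ζ => (ζ / minkowski D a) • a, ⟨?_, ?_⟩, ?_, ?_⟩
  · exact Differentiable.differentiableOn (by fun_prop)
  · intro ζ hζ
    have hlt : minkowski D ((ζ / minkowski D a) • a) < 1 := by
      rw [minkowski_smul hbal, norm_div, Complex.norm_real, Real.norm_of_nonneg hDa.le,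
        div_mul_cancel₀ _ hDa.ne']
      simpa using hζ
    have habs : Absorbent ℝ D :=
      absorbent_nhds_zero (hD.mem_nhds (hbal.zero_mem ⟨a, ha⟩))
    obtain ⟨b, hb0, hb1, y, hy, hyb⟩ := exists_lt_of_gauge_lt habs hlt
    simp only at hyb ⊢
    rw [← hyb]
    change b • y ∈ D
    have : b • y = (b : ℂ) • y := by simp
    rw [this]
    refine hbal.smul_mem ?_ hy
    rw [Complex.norm_real, Real.norm_of_nonneg hb0.le]
    exact hb1.le
  · simp
  · simp [div_self hne]

theorem lempertStar_zero_le_of_disc {n : ℕ} {D : Set (EuclideanSpace ℂ (Fin n))}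
    {a : EuclideanSpace ℂ (Fin n)} {φ : ℂ → EuclideanSpace ℂ (Fin n)} (hφ : IsAnalyticDisc φ D)
    (h0 : φ 0 = 0) {α : ℂ} (hα : α ∈ ball (0 : ℂ) 1) (ha : φ α = a) :
    lempertStar D 0 a ≤ ‖α‖ := by
  have hα1 : ‖α‖ < 1 := by simpa using hα
  have hle : lempert D 0 a ≤ Real.artanh ‖α‖ := by
    refine csInf_le ⟨0, ?_⟩ ⟨α, hα, φ, hφ, h0, ha, rfl⟩
    rintro _ ⟨β, -, -, -, -, -, rfl⟩
    exact Real.artanh_nonneg (norm_nonneg _)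
  rw [← Real.tanh_artanh (x := ‖α‖) ⟨by linarith [norm_nonneg α], hα1⟩]
  exact strictMono_tanh.monotone hle

/-- The disc `φ` only ensures that the infimum is over a nonempty set, since `sInf ∅ = 0`. -/
theorem le_lempertStar_zero {n : ℕ} {D : Set (EuclideanSpace ℂ (Fin n))}
    {a : EuclideanSpace ℂ (Fin n)} {φ : ℂ → EuclideanSpace ℂ (Fin n)} (hφ : IsAnalyticDisc φ D)
    (h0 : φ 0 = 0) {α : ℂ} (hα : α ∈ ball (0 : ℂ) 1) (ha : φ α = a) {c : ℝ} (hc0 : 0 ≤ c)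
    (hc1 : c < 1) (hc : ∀ β ∈ ball (0 : ℂ) 1, ∀ ψ : ℂ → EuclideanSpace ℂ (Fin n),
      IsAnalyticDisc ψ D → ψ 0 = 0 → ψ β = a → c ≤ ‖β‖) :
    c ≤ lempertStar D 0 a := by
  have hle : Real.artanh c ≤ lempert D 0 a := by
    refine le_csInf ⟨_, α, hα, φ, hφ, h0, ha, rfl⟩ ?_
    rintro _ ⟨β, hβ, ψ, hψ, hψ0, hψβ, rfl⟩
    exact Real.artanh_le_artanh (by linarith) (by simpa using hβ) (hc β hβ ψ hψ hψ0 hψβ)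
  rw [← Real.tanh_artanh (x := c) ⟨by linarith, hc1⟩]
  exact strictMono_tanh.monotone hle

/-- Discs that almost realize the Lempert function, normalized by a rotation. -/
theorem exists_disc_of_lempertStar_lt {n : ℕ} {D : Set (EuclideanSpace ℂ (Fin n))}
    {a : EuclideanSpace ℂ (Fin n)} {φ : ℂ → EuclideanSpace ℂ (Fin n)} (hφ : IsAnalyticDisc φ D)
    (h0 : φ 0 = 0) {α : ℂ} (hα : α ∈ ball (0 : ℂ) 1) (ha : φ α = a) {c : ℝ} (hc0 : 0 ≤ c)
    (hc1 : c < 1) (hc : lempertStar D 0 a < c) :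
    ∃ t : ℝ, 0 ≤ t ∧ t < c ∧ ∃ ψ : ℂ → EuclideanSpace ℂ (Fin n),
      IsAnalyticDisc ψ D ∧ ψ 0 = 0 ∧ ψ t = a := by
  have hlt : lempert D 0 a < Real.artanh c := by
    rw [← Real.tanh_artanh (x := c) ⟨by linarith, hc1⟩] at hc
    exact strictMono_tanh.lt_iff_lt.1 hc
  obtain ⟨_, ⟨β, hβ, ψ, hψ, hψ0, hψβ, rfl⟩, hlt⟩ :=
    exists_lt_of_csInf_lt (by exact ⟨_, α, hα, φ, hφ, h0, ha, rfl⟩) hlt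
  have hβ1 : ‖β‖ < 1 := by simpa using hβ
  have hrot : ∀ ζ ∈ ball (0 : ℂ) 1, Complex.exp (Complex.arg β * Complex.I) * ζ ∈ ball (0 : ℂ) 1 :=
    fun ζ hζ => by
      rw [mem_ball_zero_iff] at hζ ⊢
      rwa [norm_mul, Complex.norm_exp_ofReal_mul_I, one_mul]
  refine ⟨‖β‖, norm_nonneg _, (Real.artanh_lt_artanh_iff ⟨by linarith [norm_nonneg β], hβ1⟩
    ⟨by linarith, hc1⟩).1 hlt, fun ζ => ψ (Complex.exp (Complex.arg β * Complex.I) * ζ),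
    ⟨?_, fun ζ hζ => hψ.2 (hrot ζ hζ)⟩, by simpa using hψ0, ?_⟩
  · exact hψ.1.comp (t := ball 0 1) (f := fun ζ => Complex.exp (Complex.arg β * Complex.I) * ζ)
      (by fun_prop) hrot
  · simp only
    rw [mul_comm, Complex.norm_mul_exp_arg_mul_I, hψβ]

theorem minkowski_le_minkowski_of_subset {n : ℕ} {D G : Set (EuclideanSpace ℂ (Fin n))}
    (hD : D ∈ 𝓝 0) (hDG : D ⊆ G) (a : EuclideanSpace ℂ (Fin n)) :
    minkowski G a ≤ minkowski D a :=
  gauge_mono (absorbent_nhds_zero hD) hDG a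

/-- Continuity of the Minkowski function at `a` propagates the bound `1` along discs converging to
the linear disc in the direction of `a`. -/
theorem minkowski_le_of_tendsto {n : ℕ} {D : Set (EuclideanSpace ℂ (Fin n))}
    (hbal : Balanced ℂ D) {a : EuclideanSpace ℂ (Fin n)} (hcont : ContinuousAt (minkowski D) a)
    {s : ℝ} (hs : 0 < s) {ι : Type*} {l : Filter ι} [l.NeBot]
    {φ : ι → ℂ → EuclideanSpace ℂ (Fin n)} (hφ : ∀ i, MapsTo (φ i) (ball 0 1) D)
    (hlim : ∀ ζ ∈ ball (0 : ℂ) 1, Tendsto (fun i => φ i ζ) l (𝓝 (ζ • (s : ℂ)⁻¹ • a))) :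
    minkowski D a ≤ s := by
  have hs' : (s : ℂ) ≠ 0 := by exact_mod_cast hs.ne'
  have key : ∀ t : ℝ, t ∈ Ioo (0 : ℝ) 1 → t * minkowski D a ≤ s := fun t ht => by
    have ht' : (t : ℂ) ≠ 0 := by exact_mod_cast ht.1.ne'
    have htm : (t : ℂ) ∈ ball (0 : ℂ) 1 := by
      rw [mem_ball_zero_iff, Complex.norm_real, Real.norm_of_nonneg ht.1.le]
      exact ht.2
    -- Rescaling moves the limit point to `a`, the only point where continuity is available.
    have h1 : Tendsto (fun i => ((s : ℂ) * (t : ℂ)⁻¹) • φ i t) l (𝓝 a) := by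
      have := (hlim t htm).const_smul ((s : ℂ) * (t : ℂ)⁻¹)
      rwa [smul_smul, smul_smul, mul_assoc (s : ℂ), inv_mul_cancel₀ ht', mul_one,
        mul_inv_cancel₀ hs', one_smul] at this
    have h2 : minkowski D a ≤ s * t⁻¹ := by
      refine le_of_tendsto (hcont.tendsto.comp h1) (Eventually.of_forall fun i => ?_)
      have h3 : minkowski D (φ i t) ≤ 1 := gauge_le_one_of_mem (hφ i htm)
      have h4 : 0 ≤ s * t⁻¹ := mul_nonneg hs.le (inv_nonneg.2 ht.1.le)
      simp only [Function.comp]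
      rw [minkowski_smul hbal, ← Complex.ofReal_inv, ← Complex.ofReal_mul, Complex.norm_real,
        Real.norm_of_nonneg h4]
      exact mul_le_of_le_one_right h4 h3
    rw [← div_eq_mul_inv, le_div_iff₀ ht.1] at h2
    linarith
  have htend : Tendsto (fun t : ℝ => t * minkowski D a) (𝓝[<] 1) (𝓝 (1 * minkowski D a)) :=
    ((continuous_id.mul continuous_const).tendsto 1).mono_left nhdsWithin_le_nhds
  rw [one_mul] at htend
  exact le_of_tendsto htend (by filter_upwards [Ioo_mem_nhdsLT zero_lt_one] with t ht using key t ht)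

/-! ### Limits of almost extremal discs and the equivalence. -/

theorem minkowski_le_of_lempertStar_eq {n : ℕ} {D G : Set (EuclideanSpace ℂ (Fin n))}
    (hD_open : IsOpen D) (hD_bdd : Bornology.IsBounded D) (hD_bal : Balanced ℂ D)
    (hG_open : IsOpen G) (hG_bal : Balanced ℂ G) (hG_psc : IsPseudoconvex G) (hDG : D ⊆ G)
    {a : EuclideanSpace ℂ (Fin n)} (ha : a ∈ D) (hcont : ContinuousAt (minkowski D) a)
    (hGa : 0 < minkowski G a)
    (hdisc : NoNontrivialAnalyticDiscThrough (closure G) ((minkowski G a)⁻¹ • a))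
    (heq : lempertStar D 0 a = minkowski G a) : minkowski D a ≤ minkowski G a := by
  set s := minkowski G a with hs
  have hs1 : s < 1 := gauge_lt_one_of_mem_of_isOpen hG_open (hDG ha)
  have hDn : D ∈ 𝓝 0 := hD_open.mem_nhds (hD_bal.zero_mem ⟨a, ha⟩)
  obtain ⟨hD1, φ₀, hφ₀, hφ₀0, hφ₀a⟩ := exists_linear_disc hD_open hD_bal ha
    (hGa.trans_le (minkowski_le_minkowski_of_subset hDn hDG a))
  have hDmem : (minkowski D a : ℂ) ∈ ball (0 : ℂ) 1 := by
    rw [mem_ball_zero_iff, Complex.norm_real, Real.norm_of_nonneg (minkowski_nonneg _ a)]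
    exact hD1
  -- The shift by 2 keeps the bound strictly below 1 even for `j = 0`.
  have hex : ∀ j : ℕ, ∃ t : ℝ, 0 ≤ t ∧ t < s + (1 - s) * (1 / ((j : ℝ) + 2)) ∧
      ∃ ψ : ℂ → EuclideanSpace ℂ (Fin n), IsAnalyticDisc ψ D ∧ ψ 0 = 0 ∧ ψ t = a := fun j => by
    have h1 : 0 < (1 - s) * (1 / ((j : ℝ) + 2)) := mul_pos (by linarith) (by positivity)
    have h2 : 1 / ((j : ℝ) + 2) < 1 := by
      rw [div_lt_one (by positivity)]
      have : (0 : ℝ) ≤ j := Nat.cast_nonneg j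
      linarith
    exact exists_disc_of_lempertStar_lt hφ₀ hφ₀0 hDmem hφ₀a (by linarith) (by nlinarith)
      (by linarith)
  choose t ht0 htlt φ hφ hφ0 hφt using hex
  have htlim : Tendsto (fun j : ℕ => s + (1 - s) * (1 / ((j : ℝ) + 2))) atTop (𝓝 s) := by
    have h1 : Tendsto (fun j : ℕ => (j : ℝ) + 2) atTop atTop :=
      tendsto_atTop_add_const_right _ _ tendsto_natCast_atTop_atTop
    have h2 := ((tendsto_const_nhds (x := (1 : ℝ))).div_atTop h1).const_mul (1 - s)
    simpa using h2.const_add s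
  have htmem : ∀ j, (t j : ℂ) ∈ ball (0 : ℂ) 1 := fun j => by
    rw [mem_ball_zero_iff, Complex.norm_real, Real.norm_of_nonneg (ht0 j)]
    refine (htlt j).trans ?_
    have h2 : 1 / ((j : ℝ) + 2) < 1 := by
      rw [div_lt_one (by positivity)]
      have : (0 : ℝ) ≤ j := Nat.cast_nonneg j
      linarith
    nlinarith
  have hφG : ∀ j, IsAnalyticDisc (φ j) G := fun j => ⟨(hφ j).1, fun ζ hζ => hDG ((hφ j).2 hζ)⟩
  have hst : ∀ j, s ≤ t j := fun j => by
    have := minkowski_le_norm_of_isAnalyticDisc hG_open hG_bal hG_psc (hφG j) (hφ0 j) (htmem j)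
    rwa [hφt, Complex.norm_real, Real.norm_of_nonneg (ht0 j)] at this
  -- Along an ultrafilter all pointwise limits exist at once, so no subsequence is extracted.
  let l : Filter ℕ := hyperfilter ℕ
  have htl : Tendsto (fun j => (t j : ℂ)) l (𝓝 (s : ℂ)) :=
    (Complex.continuous_ofReal.tendsto s).comp ((tendsto_of_tendsto_of_tendsto_of_le_of_le
      tendsto_const_nhds htlim hst fun j => (htlt j).le).mono_left Nat.hyperfilter_le_atTop)
  obtain ⟨B, hB⟩ := hD_bdd.exists_norm_le
  have hφB : ∀ j, ∀ ζ ∈ ball (0 : ℂ) 1, ‖φ j ζ‖ ≤ B := fun j ζ hζ => hB _ ((hφ j).2 hζ)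
  have hlim : ∀ ζ : ℂ, ∃ p, ζ ∈ ball (0 : ℂ) 1 → Tendsto (fun j => φ j ζ) l (𝓝 p) := fun ζ => by
    by_cases hζ : ζ ∈ ball (0 : ℂ) 1
    · obtain ⟨p, -, hp⟩ := hD_bdd.isCompact_closure.ultrafilter_le_nhds
        ((hyperfilter ℕ).map fun j => φ j ζ) (by
          rw [le_principal_iff]
          exact Filter.mem_map.2 (univ_mem' fun j => subset_closure ((hφ j).2 hζ)))
      exact ⟨p, fun _ => hp⟩
    · exact ⟨0, fun h => absurd h hζ⟩
  choose ψ hψ using hlim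
  have hψd : DifferentiableOn ℂ ψ (ball 0 1) :=
    differentiableOn_of_tendsto_of_norm_le (fun j => (hφ j).1) hφB hψ
  have hψ0 : ψ 0 = 0 := by
    refine tendsto_nhds_unique (hψ 0 (mem_ball_self one_pos)) ?_
    simp only [hφ0]
    exact tendsto_const_nhds
  have hsmem : (s : ℂ) ∈ ball (0 : ℂ) 1 := by
    rw [mem_ball_zero_iff, Complex.norm_real, Real.norm_of_nonneg hGa.le]
    exact hs1
  have hψs : ψ s = a := by
    refine tendsto_nhds_unique (tendsto_comp_of_tendsto_of_norm_le (fun j => (hφ j).1) hφB hsmem htl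
      (hψ s hsmem)) ?_
    simp only [hφt]
    exact tendsto_const_nhds
  have hs0 : (s : ℂ) ≠ 0 := by exact_mod_cast hGa.ne'
  have hdd := differentiableOn_dslope_zero hψd
  have hne : ∀ ζ ∈ ball (0 : ℂ) 1, ζ ≠ 0 → dslope ψ 0 ζ ∈ closure G := fun ζ hζ hζ0 => by
    rw [dslope_zero_eq_inv_smul hψ0 hζ0]
    refine isClosed_closure.mem_of_tendsto ((hψ ζ hζ).const_smul ζ⁻¹)
      (Eventually.of_forall fun j => ?_)
    rw [← dslope_zero_eq_inv_smul (hφ0 j) hζ0]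
    exact dslope_mem_closure_of_isPseudoconvex hG_open hG_bal hG_psc (hφG j) (hφ0 j) hζ
  -- At 0 the quotient is a derivative, not a pointwise limit of quotients; its value is reached by
  -- continuity.
  have hmaps : MapsTo (dslope ψ 0) (ball 0 1) (closure G) := fun ζ hζ => by
    by_cases hζ0 : ζ = 0
    · subst hζ0
      have hc : ContinuousAt (dslope ψ 0) 0 :=
        (hdd.differentiableAt (ball_mem_nhds _ one_pos)).continuousAt
      refine isClosed_closure.mem_of_tendsto
        (hc.tendsto.mono_left (nhdsWithin_le_nhds (s := {0}ᶜ))) ?_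
      filter_upwards [self_mem_nhdsWithin, mem_nhdsWithin_of_mem_nhds
        (ball_mem_nhds (0 : ℂ) one_pos)] with ζ h1 h2 using hne ζ h2 h1
    · exact hne ζ hζ hζ0
  have hsa : (s⁻¹ : ℝ) • a = (s : ℂ)⁻¹ • a := by
    rw [← Complex.ofReal_inv]
    exact RCLike.real_smul_eq_coe_smul _ _
  have hconst := hdisc (dslope ψ 0) ⟨hdd, hmaps⟩
    ⟨s, hsmem, by rw [dslope_zero_eq_inv_smul hψ0 hs0, hψs, hsa]⟩
  refine minkowski_le_of_tendsto hD_bal hcont hGa (l := l) (fun j => (hφ j).2) fun ζ hζ => ?_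
  have h1 := sub_smul_dslope ψ 0 ζ
  rw [hconst ζ hζ, sub_zero, hψ0, sub_zero, hsa] at h1
  rw [h1]
  exact hψ ζ hζ

theorem proposition3 (n : ℕ) (D G : Set (EuclideanSpace ℂ (Fin n)))
    (hD_open : IsOpen D) (hD_conn : IsConnected D) (hD_bdd : Bornology.IsBounded D)
    (hD_bal : Balanced ℂ D)
    (hG_open : IsOpen G) (hG_conn : IsConnected G) (hG_bal : Balanced ℂ G)
    (hG_psc : IsPseudoconvex G) (hDG : D ⊆ G)
    (a : EuclideanSpace ℂ (Fin n)) (ha : a ∈ D)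
    (hcont : ContinuousAt (minkowski D) a)
    (hGa : minkowski G a ≠ 0)
    (hdisc : NoNontrivialAnalyticDiscThrough (closure G) ((minkowski G a)⁻¹ • a)) :
    lempertStar D 0 a = minkowski G a ↔ minkowski D a = minkowski G a := by
  have hGpos : 0 < minkowski G a := lt_of_le_of_ne (minkowski_nonneg _ a) hGa.symm
  have hDn : D ∈ 𝓝 0 := hD_open.mem_nhds (hD_bal.zero_mem ⟨a, ha⟩)
  have hGD := minkowski_le_minkowski_of_subset hDn hDG a
  constructor
  · exact fun heq => le_antisymm (minkowski_le_of_lempertStar_eq hD_open hD_bdd hD_bal hG_open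
      hG_bal hG_psc hDG ha hcont hGpos hdisc heq) hGD
  · intro heq
    obtain ⟨hD1, φ, hφ, hφ0, hφa⟩ := exists_linear_disc hD_open hD_bal ha (hGpos.trans_le hGD)
    have hnorm : ‖(minkowski D a : ℂ)‖ = minkowski D a := by
      rw [Complex.norm_real, Real.norm_of_nonneg (minkowski_nonneg _ a)]
    have hmem : (minkowski D a : ℂ) ∈ ball (0 : ℂ) 1 := by
      rwa [mem_ball_zero_iff, hnorm]
    refine le_antisymm ?_ ?_
    · have := lempertStar_zero_le_of_disc hφ hφ0 hmem hφa
      rwa [hnorm, heq] at this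
    · refine le_lempertStar_zero hφ hφ0 hmem hφa hGpos.le (heq ▸ hD1) fun β hβ ψ hψ hψ0 hψβ => ?_
      have := minkowski_le_norm_of_isAnalyticDisc hG_open hG_bal hG_psc
        ⟨hψ.1, fun ζ hζ => hDG (hψ.2 hζ)⟩ hψ0 hβ
      rwa [hψβ] at this
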